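/- Let $R$ be an associative ring with $1$ that is left and right noetherian; modules are left $R$-modules. A module $G$ is Gorenstein injective if there is an exact complex $\cdots\to E_1\to E_0\to E_{-1}\to\cdots$ of injective modules which remains exact under $\mathrm{Hom}(I,-)$ for every injective module $I$, with $G\cong\ker(E_0\to E_{-1})$. Let $\mathcal{GI}$ be the class of Gorenstein injective modules, and let $\mathcal{GI}^{\perp}$ be the class of modules $K$ with $\mathrm{Ext}^1_R(F,K)=0$ for all $F\in\mathcal{GI}$. A homomorphism $\varphi:E\to X$ is a Gorenstein injective precover of $X$ if $E\in\mathcal{GI}$ and $\mathrm{Hom}(F,E)\to\mathrm{Hom}(F,X)$ is surjective for all $F\in\mathcal{GI}$. A precover is special if moreover $\ker\varphi\in\mathcal{GI}^{\perp}$ ($\varphi$ need not be surjective), and it is a cover if every $f:E\to E$ with $\varphi f=\varphi$ is an automorphism. The class $\mathcal{GI}$ is covering if every module has a Gorenstein injective cover. A direct transfinite extension of modules in $\mathcal{GI}$ is a module $X\cong\varinjlim X_\alpha$ for a direct system of monomorphisms $(X_\alpha\mid\alpha\le\lambda)$ indexed by the ordinals up to some ordinal $\lambda$, with $X_0=0$,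 $X_\beta=\varinjlim_{\alpha<\beta}X_\alpha$ for limit ordinals $\beta\le\lambda$, and $\mathrm{coker}(X_\alpha\to X_{\alpha+1})\in\mathcal{GI}$ whenever $\alpha+1\le\lambda$. For a class $\mathcal{X}$ of modules, a module $M$ is $\mathcal{X}$-filtered, written $M\in\mathrm{Filt}(\mathcal{X})$, if for some ordinal $\lambda$ there is an increasing chain $(M_\alpha\mid\alpha\le\lambda)$ of submodules of $M$ with $M_0=0$, $M_\lambda=M$, $M_\beta=\bigcup_{\alpha<\beta}M_\alpha$ for limit ordinals $\beta\le\lambda$, and $M_{\alpha+1}/M_\alpha$ isomorphic to a member of $\mathcal{X}$ whenever $\alpha+1\le\lambda$. Then: 1. If every $R$-module has a special Gorenstein injective precover, then $\mathcal{GI}$ is closed under direct transfinite extensions. 2. If $\mathcal{GI}$ is covering, then every $R$-module has a special Gorenstein injective precover. 3. If $\mathcal{GI}$ is covering, then $\mathcal{GI}$ is closed under direct transfinite extensions. 4. Suppose every $R$-module has a special Gorenstein injective precover. Let $\kappa$ be any cardinal and let $\mathcal{X}$ be a set of representatives of the isomorphism classes of Gorenstein injective modules $M$ with $|M|\le\kappa$.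 Then $\mathcal{GI}$ is closed under $\mathcal{X}$-filtrations, that is, $\mathrm{Filt}(\mathcal{X})\subseteq\mathcal{GI}$. -/

import Mathlib

open CategoryTheory CategoryTheory.Limits

universe u

namespace GorInj

section Classes

variable {R : Type u} [Ring R]

/-- `G` is Gorenstein injective: there is an exact complex
`⋯ ⟶ E₁ ⟶ E₀ ⟶ E₋₁ ⟶ ⋯` of injective modules which stays exact under `Hom(I, -)` for every
injective module `I`, such that `G ≅ Ker (E₀ ⟶ E₋₁)`. -/
def IsGorensteinInjective (G : ModuleCat.{u} R) : Prop :=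
  ∃ E : ChainComplex (ModuleCat.{u} R) ℤ,
    (∀ n : ℤ, Injective (E.X n)) ∧
    E.Acyclic ∧
    (∀ I : ModuleCat.{u} R, Injective I →
      (((preadditiveCoyoneda.obj (Opposite.op I)).mapHomologicalComplex
        (ComplexShape.down ℤ)).obj E).Acyclic) ∧
    Nonempty (G ≅ kernel (E.d 0 (-1)))

variable (R) in
/-- The class `GI` of Gorenstein injective left `R`-modules. -/
def GI : ObjectProperty (ModuleCat.{u} R) := fun G => IsGorensteinInjective G

/-- `φ : E ⟶ X` is an `L`-precover of `X`. -/
def IsPrecover (L : ObjectProperty (ModuleCat.{u} R)) {E X : ModuleCat.{u} R}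
    (φ : E ⟶ X) : Prop :=
  L E ∧ ∀ F : ModuleCat.{u} R, L F → ∀ g : F ⟶ X, ∃ h : F ⟶ E, h ≫ φ = g

/-- `φ : E ⟶ X` is an `L`-cover of `X`. -/
def IsCover (L : ObjectProperty (ModuleCat.{u} R)) {E X : ModuleCat.{u} R}
    (φ : E ⟶ X) : Prop :=
  IsPrecover L φ ∧ ∀ f : E ⟶ E, f ≫ φ = φ → IsIso f

/-- The class `L^⊥` of all modules `K` with `Ext¹(F, K) = 0` for every `F` in `L`. -/
def rightExtOrthogonal (L : ObjectProperty (ModuleCat.{u} R)) :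
    ObjectProperty (ModuleCat.{u} R) :=
  fun K => ∀ F : ModuleCat.{u} R, L F → Subsingleton (Abelian.Ext F K 1)

/-- `φ : E ⟶ X` is a special `L`-precover of `X`: an `L`-precover with kernel in `L^⊥`
(it is not required to be surjective). -/
def IsSpecialPrecover (L : ObjectProperty (ModuleCat.{u} R)) {E X : ModuleCat.{u} R}
    (φ : E ⟶ X) : Prop :=
  IsPrecover L φ ∧ rightExtOrthogonal L (kernel φ)

/-- Every module has a special `L`-precover. -/
def IsSpecialPrecovering (L : ObjectProperty (ModuleCat.{u} R)) : Prop :=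
  ∀ X : ModuleCat.{u} R, ∃ (E : ModuleCat.{u} R) (φ : E ⟶ X), IsSpecialPrecover L φ

/-- The class `L` is covering: every module has an `L`-cover. -/
def IsCovering (L : ObjectProperty (ModuleCat.{u} R)) : Prop :=
  ∀ X : ModuleCat.{u} R, ∃ (E : ModuleCat.{u} R) (φ : E ⟶ X), IsCover L φ

/-- A direct system `(X_α | α ≤ lam)` of modules is continuous if `X_0 = 0` and `X_β` is the
direct limit of the `X_α`, `α < β`, for each limit ordinal `β ≤ lam`. -/
def IsContinuousSystem {lam : Ordinal.{u}} (F : Set.Iic lam ⥤ ModuleCat.{u} R) : Prop :=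
  IsZero (F.obj ⟨0, Set.mem_Iic.2 zero_le⟩) ∧
  ∀ β : Set.Iic lam, Order.IsSuccLimit (β : Ordinal.{u}) →
    Nonempty (IsColimit ((Set.principalSegIio β).cocone F))

/-- `X` is a direct transfinite extension of objects of `L`. -/
def IsDirectTransfiniteExtension (L : ObjectProperty (ModuleCat.{u} R))
    (X : ModuleCat.{u} R) : Prop :=
  ∃ (lam : Ordinal.{u}) (F : Set.Iic lam ⥤ ModuleCat.{u} R),
    IsContinuousSystem F ∧
    (∀ (α β : Set.Iic lam) (f : α ⟶ β), Mono (F.map f)) ∧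
    (∀ (α β : Set.Iic lam) (f : α ⟶ β), (β : Ordinal.{u}) = Order.succ (α : Ordinal.{u}) →
      L (cokernel (F.map f))) ∧
    ∃ c : Cocone F, Nonempty (IsColimit c) ∧ Nonempty (X ≅ c.pt)

/-- `L` is closed under direct transfinite extensions. -/
def IsClosedUnderDirectTransfiniteExtensions (L : ObjectProperty (ModuleCat.{u} R)) : Prop :=
  ∀ X : ModuleCat.{u} R, IsDirectTransfiniteExtension L X → L X

/-- The submodules `N α`, `α ≤ lam`, form a `C`-filtration of length `lam` of `M`
(the values `N α` for `α > lam` are irrelevant). -/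
structure IsFiltration (C : ObjectProperty (ModuleCat.{u} R)) (M : ModuleCat.{u} R)
    (lam : Ordinal.{u}) (N : Ordinal.{u} → Submodule R M) : Prop where
  mono : ∀ α β : Ordinal.{u}, α ≤ β → β ≤ lam → N α ≤ N β
  zero : N 0 = ⊥
  top : N lam = ⊤
  limit : ∀ β : Ordinal.{u}, Order.IsSuccLimit β → β ≤ lam →
    N β = ⨆ α : Set.Iio β, N α
  quot : ∀ α : Ordinal.{u}, α < lam → ∃ D : ModuleCat.{u} R, C D ∧
    Nonempty ((↥(N (Order.succ α)) ⧸ (N α).submoduleOf (N (Order.succ α))) ≃ₗ[R] D)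

/-- The class `Filt(C)` of all `C`-filtered modules. -/
def Filt (C : ObjectProperty (ModuleCat.{u} R)) : ObjectProperty (ModuleCat.{u} R) :=
  fun M => ∃ (lam : Ordinal.{u}) (N : Ordinal.{u} → Submodule R M), IsFiltration C M lam N

/-- `X` consists of exactly one representative of each isomorphism class of Gorenstein injective
modules `M` with `|M| ≤ κ`. -/
def IsSmallGIRepresentatives (κ : Cardinal.{u}) (X : ObjectProperty (ModuleCat.{u} R)) : Prop :=
  (∀ M, X M → GI R M ∧ Cardinal.mk M ≤ κ) ∧
  ∀ M, GI R M → Cardinal.mk M ≤ κ → ∃! N, X N ∧ Nonempty (M ≅ N)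

end Classes

end GorInj

/-! The heart is the limit step. Let `M` be a union of a continuous chain of Gorenstein injective
submodules with Gorenstein injective quotients, and let `φ : E ⟶ M` be a special precover with
kernel `K`. Each inclusion of a stage factors through `φ`, so `φ` is surjective. Eklof's lemma
(`IsFiltration.exists_lift`) gives `Ext¹(M, K) = 0`, so `φ` splits and `M` is a retract of `E`.
Closure under extensions handles successor steps, and closure under retracts finishes limit steps.

Both closure properties come from `isGorensteinInjective_of_class`: the coresolution half of the
complex exists as soon as `Extⁱ(I, -)` vanishes for injective `I` and `i ≥ 1`, so only the left half
has to be built. Special precovers are obtained from covers by Wakamatsu's lemma, which needs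
closure under extensions. Direct transfinite extensions become filtrations by passing to images in
the last term of the system. -/

namespace GorInj

section

variable {R : Type u} [Ring R]

/-! ### Complexes of injectives as spliced short exact sequences -/

/-- There is a short exact sequence `0 ⟶ A ⟶ E ⟶ B ⟶ 0` with `E` injective which stays exact
under `Hom(I, -)` for every injective module `I`. -/
def IsInjectiveStep (A B : ModuleCat.{u} R) : Prop :=
  ∃ (E : ModuleCat.{u} R) (f : A ⟶ E) (g : E ⟶ B) (w : f ≫ g = 0),
    (ShortComplex.mk f g w).ShortExact ∧ Injective E ∧
      ∀ I : ModuleCat.{u} R, Injective I → ∀ v : I ⟶ B, ∃ h : I ⟶ E, h ≫ g = v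

lemma isInjectiveStep_kernel {X Y Z : ModuleCat.{u} R} (f : X ⟶ Y) (g : Y ⟶ Z) (w : f ≫ g = 0)
    (hX : Injective X) (he : (ShortComplex.mk f g w).Exact)
    (hI : ∀ I : ModuleCat.{u} R, Injective I → ∀ v : I ⟶ Y, v ≫ g = 0 → ∃ h : I ⟶ X, h ≫ f = v) :
    IsInjectiveStep (kernel f) (kernel g) := by
  refine ⟨X, kernel.ι f, kernel.lift g f w, ?_, ?_, hX, ?_⟩
  · rw [← cancel_mono (kernel.ι g)]
    simp
  · have : Epi (kernel.lift g f w) := he.epi_kernelLift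
    refine { exact := ?_, mono_f := inferInstanceAs (Mono (kernel.ι f)), epi_g := this }
    refine ShortComplex.exact_of_f_is_kernel _
      (isKernelOfComp (kernel.ι g) f (kernelIsKernel f) ?_ ?_)
    · simp [← cancel_mono (kernel.ι g)]
    · simp
  · intro I hI' v
    obtain ⟨h, hh⟩ := hI I hI' (v ≫ kernel.ι g) (by simp)
    exact ⟨h, by rw [← cancel_mono (kernel.ι g)]; simpa using hh⟩

lemma acyclic_map_preadditiveCoyoneda_iff (E : ChainComplex (ModuleCat.{u} R) ℤ)
    (I : ModuleCat.{u} R) :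
    (((preadditiveCoyoneda.obj (Opposite.op I)).mapHomologicalComplex
        (ComplexShape.down ℤ)).obj E).Acyclic ↔
      ∀ (n : ℤ) (v : I ⟶ E.X n), v ≫ E.d n (n - 1) = 0 →
        ∃ h : I ⟶ E.X (n + 1), h ≫ E.d (n + 1) n = v := by
  refine forall_congr' fun n => ?_
  rw [HomologicalComplex.exactAt_iff' _ (n + 1) n (n - 1) (by simp) (by simp),
    ShortComplex.ab_exact_iff]
  rfl

lemma IsGorensteinInjective.exists_isInjectiveStep {G : ModuleCat.{u} R}
    (hG : IsGorensteinInjective G) :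
    ∃ Z : ℤ → ModuleCat.{u} R, Nonempty (G ≅ Z 0) ∧ ∀ n, IsInjectiveStep (Z (n + 1)) (Z n) := by
  obtain ⟨E, hE, hac, hI, e⟩ := hG
  refine ⟨fun n => kernel (E.d n (n - 1)), by simpa using e, fun n => ?_⟩
  -- The free index `m` absorbs the rewriting of `n + 1 - 1` to `n` inside the kernel.
  have key : ∀ m : ℤ, m = n → IsInjectiveStep (kernel (E.d (n + 1) m))
      (kernel (E.d n (n - 1))) := by
    rintro m rfl
    refine isInjectiveStep_kernel _ _ (E.d_comp_d _ _ _) (hE _) ?_ fun I hI' v hv =>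
      (acyclic_map_preadditiveCoyoneda_iff E I).1 (hI I hI') m v hv
    exact (E.exactAt_iff' (m + 1) m (m - 1) (by simp) (by simp)).1 (hac m)
  exact key _ (by simp)

lemma isGorensteinInjective_of_isInjectiveStep {G : ModuleCat.{u} R} (Z : ℤ → ModuleCat.{u} R)
    (e : G ≅ Z 0) (hZ : ∀ n, IsInjectiveStep (Z (n + 1)) (Z n)) : IsGorensteinInjective G := by
  -- Shift so that `G ≅ Z 1`: with `E n` placed between `Z (n + 1)` and `Z n`, the kernel of `E 0 ⟶
  -- E (-1)` is `Z 1`.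
  obtain ⟨Z, e, hZ⟩ : ∃ Z : ℤ → ModuleCat.{u} R, Nonempty (G ≅ Z (0 + 1)) ∧
      ∀ n, IsInjectiveStep (Z (n + 1)) (Z n) :=
    ⟨fun n => Z (n - 1), by simpa using ⟨e⟩, fun n => by
      have := hZ (n - 1)
      rwa [show n - 1 + 1 = n + 1 - 1 by ring] at this⟩
  choose E f g w hex hE hI using hZ
  have hmono (n) : Mono (f n) := (hex n).mono_f
  have hepi (n) : Epi (g n) := (hex n).epi_g
  let d (n : ℤ) : E (n + 1) ⟶ E n := g (n + 1) ≫ f n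
  have sq (n) : d (n + 1) ≫ d n = 0 := by simp [d, reassoc_of% (w (n + 1))]
  let K := ChainComplex.of E d sq
  have hd (n) : K.d (n + 1) n = d n := ChainComplex.of_d E d n
  have hd' (n m) (h : m + 1 = n) : ∃ j : Z n ⟶ E m, Mono j ∧ K.d n m = g n ≫ j := by
    subst h
    exact ⟨f m, hmono m, hd m⟩
  refine ⟨K, hE, fun n => ?_, fun I hI' => ?_, ?_⟩
  · rw [HomologicalComplex.exactAt_iff' _ (n + 1) n (n - 1) (by simp) (by simp)]
    obtain ⟨j, hj, hj'⟩ := hd' n (n - 1) (by simp)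
    rw [ShortComplex.moduleCat_exact_iff]
    intro x hx
    change E n at x
    replace hx : K.d n (n - 1) x = 0 := hx
    rw [hj'] at hx
    have hx' : g n x = 0 := (ModuleCat.mono_iff_injective j).1 hj (hx.trans (map_zero _).symm)
    obtain ⟨y, hy⟩ := (ShortComplex.moduleCat_exact_iff _).1 (hex n).exact x hx'
    obtain ⟨z, rfl⟩ := (ModuleCat.epi_iff_surjective _).1 (hepi (n + 1)) y
    refine ⟨z, Eq.trans ?_ hy⟩
    change K.d (n + 1) n z = _
    rw [hd]
    rfl
  · rw [acyclic_map_preadditiveCoyoneda_iff]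
    intro n v hv
    obtain ⟨j, hj, hj'⟩ := hd' n (n - 1) (by simp)
    rw [hj', ← Category.assoc] at hv
    have hv' := zero_of_comp_mono j hv
    obtain ⟨h, hh⟩ := hI (n + 1) I hI' ((hex n).exact.lift v hv')
    refine ⟨h, ?_⟩
    rw [hd]
    dsimp only [d]
    rw [reassoc_of% hh]
    exact (hex n).exact.lift_f v hv'
  · obtain ⟨j, hj, hj'⟩ := hd' 0 (-1) (by simp)
    obtain ⟨e⟩ := e
    refine ⟨e ≪≫ ((hex 0).fIsKernel.conePointUniqueUpToIso (kernelIsKernel (g 0))) ≪≫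
      (kernelCompMono (g 0) j).symm ≪≫ kernelIsoOfEq hj'.symm⟩

/-! ### Vanishing of Ext along short exact sequences -/

open Abelian

lemma exists_lift_of_subsingleton_ext {S : ShortComplex (ModuleCat.{u} R)} (hS : S.ShortExact)
    {X : ModuleCat.{u} R} (h : Subsingleton (Ext X S.X₁ 1)) (v : X ⟶ S.X₃) :
    ∃ t : X ⟶ S.X₂, t ≫ S.g = v := by
  obtain ⟨x, hx⟩ := Ext.covariant_sequence_exact₃ X hS (Ext.mk₀ v) (zero_add 1)
    (Subsingleton.elim _ _)
  obtain ⟨t, rfl⟩ := Ext.addEquiv₀.symm.surjective x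
  refine ⟨t, Ext.addEquiv₀.symm.injective ?_⟩
  simpa using hx

lemma subsingleton_ext_one_of_exists_lift {S : ShortComplex (ModuleCat.{u} R)}
    (hS : S.ShortExact) {X : ModuleCat.{u} R} (h₂ : Subsingleton (Ext X S.X₂ 1))
    (h : ∀ v : X ⟶ S.X₃, ∃ t : X ⟶ S.X₂, t ≫ S.g = v) : Subsingleton (Ext X S.X₁ 1) := by
  refine subsingleton_of_forall_eq 0 fun x => ?_
  obtain ⟨y, rfl⟩ := Ext.covariant_sequence_exact₁ X hS x (Subsingleton.elim _ _) (zero_add 1)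
  obtain ⟨v, rfl⟩ := Ext.addEquiv₀.symm.surjective y
  obtain ⟨t, rfl⟩ := h v
  have : Ext.addEquiv₀.symm (t ≫ S.g) = (Ext.mk₀ t).comp (Ext.mk₀ S.g) (zero_add 0) := by simp
  rw [this, Ext.comp_assoc_of_second_deg_zero, hS.comp_extClass, Ext.comp_zero]

lemma subsingleton_ext_mid {S : ShortComplex (ModuleCat.{u} R)} (hS : S.ShortExact)
    {X : ModuleCat.{u} R} {n : ℕ} (h₁ : Subsingleton (Ext X S.X₁ n))
    (h₃ : Subsingleton (Ext X S.X₃ n)) : Subsingleton (Ext X S.X₂ n) := by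
  refine subsingleton_of_forall_eq 0 fun x => ?_
  obtain ⟨y, rfl⟩ := Ext.covariant_sequence_exact₂ X hS x (Subsingleton.elim _ _)
  rw [Subsingleton.elim y 0, Ext.zero_comp]

lemma subsingleton_ext_left {S : ShortComplex (ModuleCat.{u} R)} (hS : S.ShortExact)
    {X : ModuleCat.{u} R} {n : ℕ} (h₂ : Subsingleton (Ext X S.X₂ (n + 1)))
    (h₃ : Subsingleton (Ext X S.X₃ n)) : Subsingleton (Ext X S.X₁ (n + 1)) := by
  refine subsingleton_of_forall_eq 0 fun x => ?_
  obtain ⟨y, rfl⟩ := Ext.covariant_sequence_exact₁ X hS x (Subsingleton.elim _ _) rfl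
  rw [Subsingleton.elim y 0, Ext.zero_comp]

lemma subsingleton_ext_right {S : ShortComplex (ModuleCat.{u} R)} (hS : S.ShortExact)
    {X : ModuleCat.{u} R} {n : ℕ} (h₂ : Subsingleton (Ext X S.X₂ n))
    (h₁ : Subsingleton (Ext X S.X₁ (n + 1))) : Subsingleton (Ext X S.X₃ n) := by
  refine subsingleton_of_forall_eq 0 fun x => ?_
  obtain ⟨y, rfl⟩ := Ext.covariant_sequence_exact₃ X hS x rfl (Subsingleton.elim _ _)
  rw [Subsingleton.elim y 0, Ext.zero_comp]

lemma subsingleton_ext_of_retract {X A B : ModuleCat.{u} R} {n : ℕ} (i : A ⟶ B) (r : B ⟶ A)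
    (hir : i ≫ r = 𝟙 A) (h : Subsingleton (Ext X B n)) : Subsingleton (Ext X A n) := by
  refine subsingleton_of_forall_eq 0 fun x => ?_
  have : (x.comp (Ext.mk₀ i) (add_zero n)).comp (Ext.mk₀ r) (add_zero n) = x := by
    rw [Ext.comp_assoc_of_third_deg_zero, Ext.mk₀_comp_mk₀, hir, Ext.comp_mk₀_id]
  rw [← this, Subsingleton.elim (x.comp (Ext.mk₀ i) (add_zero n)) 0, Ext.zero_comp]

/-! ### Injective acyclicity and the criterion for Gorenstein injectivity -/

/-- `Extⁱ(I, A) = 0` for all injective modules `I` and all `i ≥ 1`. -/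
def IsInjectiveAcyclic (A : ModuleCat.{u} R) : Prop :=
  ∀ I : ModuleCat.{u} R, Injective I → ∀ i : ℕ, Subsingleton (Ext I A (i + 1))

/-- For an embedding of `A` in an injective, `Ext¹(I, A) = 0` gives the lifting property, and
dimension shifting passes acyclicity to the cokernel. Iteration yields the right half of the
complex. -/
lemma IsInjectiveAcyclic.exists_isInjectiveStep {A : ModuleCat.{u} R}
    (hA : IsInjectiveAcyclic A) : ∃ B, IsInjectiveAcyclic B ∧ IsInjectiveStep A B := by
  have hS : (ShortComplex.mk (Injective.ι A) (cokernel.π (Injective.ι A)) (by simp)).ShortExact :=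
    { exact := ShortComplex.exact_cokernel _ }
  refine ⟨cokernel (Injective.ι A), fun I hI i => ?_, _, _, _, _, hS, inferInstance,
    fun I hI v => exists_lift_of_subsingleton_ext hS (hA I hI 0) v⟩
  exact subsingleton_ext_right hS (Ext.subsingleton_of_injective _ _ _) (hA I hI (i + 1))

lemma IsInjectiveStep.isInjectiveAcyclic {A B : ModuleCat.{u} R} (h : IsInjectiveStep A B)
    (hB : IsInjectiveAcyclic B) : IsInjectiveAcyclic A := by
  obtain ⟨E, f, g, w, hS, hE, hI⟩ := h
  rintro I hI' (_ | i)
  · exact subsingleton_ext_one_of_exists_lift hS (Ext.subsingleton_of_injective _ _ _) (hI I hI')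
  · exact subsingleton_ext_left hS (Ext.subsingleton_of_injective _ _ _) (hB I hI' i)

lemma exists_sequence {α : Type*} (P : α → Prop) (r : α → α → Prop)
    (h : ∀ a, P a → ∃ b, P b ∧ r a b)
    (a : α) (ha : P a) : ∃ s : ℕ → α, s 0 = a ∧ ∀ n, P (s n) ∧ r (s n) (s (n + 1)) := by
  choose! f hf hr using h
  have hP (n : ℕ) : P (f^[n] a) := by
    induction n with
    | zero => exact ha
    | succ n ih => rw [Function.iterate_succ_apply']; exact hf _ ih
  exact ⟨fun n => f^[n] a, rfl, fun n => ⟨hP n, by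
    simpa only [Function.iterate_succ_apply'] using hr _ (hP n)⟩⟩

/-- A class of modules that are acyclic for `Hom(I, -)`, `I` injective, each of which is a quotient
of an injective module by a member of the class, consists of Gorenstein injective modules. -/
lemma isGorensteinInjective_of_class (C : ObjectProperty (ModuleCat.{u} R))
    (hC : ∀ A, C A → IsInjectiveAcyclic A)
    (hC' : ∀ A, C A → ∃ (E : ModuleCat.{u} R) (g : E ⟶ A), Injective E ∧ Epi g ∧ C (kernel g))
    {G : ModuleCat.{u} R} (hG : C G) : IsGorensteinInjective G := by
  obtain ⟨L, hL, hL'⟩ := exists_sequence C (fun A B => IsInjectiveStep B A) (fun A hA => by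
    obtain ⟨E, g, hE, hg, hK⟩ := hC' A hA
    have hS : (ShortComplex.mk (kernel.ι g) g (by simp)).ShortExact :=
      { exact := ShortComplex.exact_kernel _ }
    exact ⟨_, hK, _, _, _, _, hS, hE, fun I hI v =>
      exists_lift_of_subsingleton_ext hS (hC _ hK I hI 0) v⟩) G hG
  obtain ⟨Q, hQ, hQ'⟩ := exists_sequence IsInjectiveAcyclic IsInjectiveStep
    (fun A hA => hA.exists_isInjectiveStep) G (hC G hG)
  -- Syzygies `L` sit in degrees `≥ 0` and cosyzygies `Q` in negative degrees; both start at `G`, so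
  -- `Q 0` is dropped and the junction is the step from `L 0 = Q 0` to `Q 1`.
  let Z : ℤ → ModuleCat.{u} R
    | Int.ofNat n => L n
    | Int.negSucc n => Q (n + 1)
  refine isGorensteinInjective_of_isInjectiveStep Z (eqToIso hL.symm) ?_
  rintro (n | _ | n)
  · exact (hL' n).2
  · change IsInjectiveStep (L 0) (Q 1)
    rw [hL, ← hQ]
    exact (hQ' 0).2
  · exact (hQ' (n + 1)).2

lemma isGorensteinInjective_of_iso {A B : ModuleCat.{u} R} (e : A ≅ B)
    (hB : IsGorensteinInjective B) : IsGorensteinInjective A := by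
  obtain ⟨E, h₁, h₂, h₃, ⟨e'⟩⟩ := hB
  exact ⟨E, h₁, h₂, h₃, ⟨e ≪≫ e'⟩⟩

/-- Lifting against injectives kills `Ext¹(I, -)` on every cycle module; since `Z (n + 1)` embeds in
an injective with quotient `Z n`, dimension shifting climbs in `i`, with the induction run for all
`n` at once. -/
lemma IsGorensteinInjective.isInjectiveAcyclic {G : ModuleCat.{u} R}
    (hG : IsGorensteinInjective G) : IsInjectiveAcyclic G := by
  obtain ⟨Z, ⟨e⟩, hZ⟩ := hG.exists_isInjectiveStep
  have key (I : ModuleCat.{u} R) (hI : Injective I) (i : ℕ) :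
      ∀ n, Subsingleton (Ext I (Z (n + 1)) (i + 1)) := by
    induction i with
    | zero =>
      intro n
      obtain ⟨E, f, g, w, hS, hE, hI'⟩ := hZ n
      exact subsingleton_ext_one_of_exists_lift hS (Ext.subsingleton_of_injective _ _ _)
        (hI' I hI)
    | succ i ih =>
      intro n
      obtain ⟨E, f, g, w, hS, hE, hI'⟩ := hZ n
      have := ih (n - 1)
      rw [sub_add_cancel] at this
      exact subsingleton_ext_left hS (Ext.subsingleton_of_injective _ _ _) this
  exact fun I hI i => subsingleton_ext_of_retract e.hom e.inv e.hom_inv_id (by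
    simpa only [neg_add_cancel] using key I hI i (-1))

lemma IsGorensteinInjective.exists_epi {G : ModuleCat.{u} R} (hG : IsGorensteinInjective G) :
    ∃ (E : ModuleCat.{u} R) (g : E ⟶ G), Injective E ∧ Epi g ∧
      IsGorensteinInjective (kernel g) := by
  obtain ⟨Z, ⟨e⟩, hZ⟩ := hG.exists_isInjectiveStep
  obtain ⟨E, f, g, w, hS, hE, hI⟩ := hZ 0
  have : Epi g := hS.epi_g
  refine ⟨E, g ≫ e.inv, hE, inferInstance, ?_⟩
  exact isGorensteinInjective_of_isInjectiveStep (fun n => Z (n + 1))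
    (kernelCompMono g e.inv ≪≫ (kernelIsKernel g).conePointUniqueUpToIso hS.fIsKernel)
    fun n => hZ (n + 1)

lemma isGorensteinInjective_of_isZero {A : ModuleCat.{u} R} (hA : IsZero A) :
    IsGorensteinInjective A := by
  refine isGorensteinInjective_of_class (fun A => IsZero A) (fun A hA I _ i => ?_)
    (fun A hA => ⟨A, 𝟙 A, hA.injective, inferInstance, ?_⟩) hA
  · have := hA.injective
    exact Ext.subsingleton_of_injective _ _ _
  · exact isZero_kernel_of_mono _

/-! ### Closure under extensions and retracts -/

lemma exists_kernel_ι_eq {X Y : ModuleCat.{u} R} (f : X ⟶ Y) (x : X) (hx : f x = 0) :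
    ∃ y : (kernel f : ModuleCat.{u} R), kernel.ι f y = x :=
  (ShortComplex.moduleCat_exact_iff _).1 (ShortComplex.exact_kernel f) x hx

lemma kernel_ι_injective {X Y : ModuleCat.{u} R} (f : X ⟶ Y) :
    Function.Injective (kernel.ι f) :=
  (ModuleCat.mono_iff_injective _).1 inferInstance

lemma kernel_condition_apply {X Y : ModuleCat.{u} R} (f : X ⟶ Y)
    (x : (kernel f : ModuleCat.{u} R)) : f (kernel.ι f x) = 0 :=
  congr($(kernel.condition f) x)

/-- This is the snake lemma: the connecting map lands in the cokernel of `φ.τ₁`, which vanishes. -/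
lemma exists_shortExact_kernel {S T : ShortComplex (ModuleCat.{u} R)} (φ : S ⟶ T)
    (hS : S.ShortExact) (hT : T.ShortExact) [Epi φ.τ₁] :
    ∃ (f : kernel φ.τ₁ ⟶ kernel φ.τ₂) (g : kernel φ.τ₂ ⟶ kernel φ.τ₃) (w : f ≫ g = 0),
      (ShortComplex.mk f g w).ShortExact := by
  obtain ⟨f, hf⟩ : ∃ f : kernel φ.τ₁ ⟶ kernel φ.τ₂, f ≫ kernel.ι φ.τ₂ = kernel.ι φ.τ₁ ≫ S.f :=
    ⟨kernel.map φ.τ₁ φ.τ₂ S.f T.f φ.comm₁₂, kernel.lift_ι _ _ _⟩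
  obtain ⟨g, hg⟩ : ∃ g : kernel φ.τ₂ ⟶ kernel φ.τ₃, g ≫ kernel.ι φ.τ₃ = kernel.ι φ.τ₂ ≫ S.g :=
    ⟨kernel.map φ.τ₂ φ.τ₃ S.g T.g φ.comm₂₃, kernel.lift_ι _ _ _⟩
  have h₁ (x) : kernel.ι φ.τ₂ (f x) = S.f (kernel.ι φ.τ₁ x) := congr($hf x)
  have h₂ (x) : kernel.ι φ.τ₃ (g x) = S.g (kernel.ι φ.τ₂ x) := congr($hg x)
  have w : f ≫ g = 0 := by
    rw [← cancel_mono (kernel.ι φ.τ₃), Category.assoc, hg, reassoc_of% hf, S.zero, comp_zero,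
      zero_comp]
  have c₁ (x) : T.f (φ.τ₁ x) = φ.τ₂ (S.f x) := congr($φ.comm₁₂ x)
  have c₂ (x) : T.g (φ.τ₂ x) = φ.τ₃ (S.g x) := congr($φ.comm₂₃ x)
  have hTf := hT.moduleCat_injective_f
  refine ⟨f, g, w, { exact := ?_, mono_f := ?_, epi_g := ?_ }⟩
  · rw [ShortComplex.moduleCat_exact_iff]
    intro (x : (kernel φ.τ₂ : ModuleCat.{u} R)) hx
    have hx' : S.g (kernel.ι φ.τ₂ x) = 0 := by
      rw [← h₂]
      exact (congrArg _ hx).trans (map_zero _)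
    obtain ⟨y, hy⟩ := (ShortComplex.moduleCat_exact_iff _).1 hS.exact _ hx'
    obtain ⟨z, hz⟩ := exists_kernel_ι_eq φ.τ₁ y (hTf (by
      rw [c₁, hy, map_zero, kernel_condition_apply]))
    exact ⟨z, kernel_ι_injective _ ((h₁ z).trans ((congrArg S.f hz).trans hy))⟩
  · rw [ModuleCat.mono_iff_injective]
    intro x y hxy
    have := congrArg (kernel.ι φ.τ₂) hxy
    exact kernel_ι_injective _ (hS.moduleCat_injective_f ((h₁ x).symm.trans (this.trans (h₁ y))))
  · rw [ModuleCat.epi_iff_surjective]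
    intro (x : (kernel φ.τ₃ : ModuleCat.{u} R))
    obtain ⟨y, hy⟩ := hS.moduleCat_surjective_g (kernel.ι φ.τ₃ x)
    obtain ⟨a, ha⟩ := (ShortComplex.moduleCat_exact_iff _).1 hT.exact (φ.τ₂ y) (by
      rw [c₂, hy, kernel_condition_apply])
    obtain ⟨b, rfl⟩ := (ModuleCat.epi_iff_surjective φ.τ₁).1 inferInstance a
    obtain ⟨z, hz⟩ := exists_kernel_ι_eq φ.τ₂ (y - S.f b) (by
      rw [map_sub, ← ha, c₁, sub_self])
    refine ⟨z, kernel_ι_injective _ ((h₂ z).trans ?_)⟩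
    rw [hz, map_sub, hy, S.moduleCat_zero_apply, sub_zero]

/-- Gorenstein injective modules are closed under extensions. -/
lemma isGorensteinInjective_of_shortExact {S : ShortComplex (ModuleCat.{u} R)}
    (hS : S.ShortExact) (h₁ : IsGorensteinInjective S.X₁) (h₃ : IsGorensteinInjective S.X₃) :
    IsGorensteinInjective S.X₂ := by
  refine isGorensteinInjective_of_class (fun B => ∃ (A D : ModuleCat.{u} R) (f : A ⟶ B)
    (g : B ⟶ D) (w : f ≫ g = 0), (ShortComplex.mk f g w).ShortExact ∧
      IsGorensteinInjective A ∧ IsGorensteinInjective D) ?_ ?_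
    ⟨_, _, S.f, S.g, S.zero, hS, h₁, h₃⟩
  · rintro B ⟨A, D, f, g, w, hS, hA, hD⟩ I hI i
    exact subsingleton_ext_mid hS (hA.isInjectiveAcyclic I hI i) (hD.isInjectiveAcyclic I hI i)
  · rintro B ⟨A, D, f, g, w, hS, hA, hD⟩
    obtain ⟨E, a, hE, ha, hKa⟩ := hA.exists_epi
    obtain ⟨F, d, hF, hd, hKd⟩ := hD.exists_epi
    -- Horseshoe construction: `F` is not projective, but `Ext¹(F, A) = 0` still lifts `d` to `B`.
    -- The kernel of the resulting `E ⊞ F ⟶ B` is an extension of `kernel d` by `kernel a`.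
    obtain ⟨t, ht⟩ := exists_lift_of_subsingleton_ext hS (hA.isInjectiveAcyclic F hF 0) d
    dsimp at t ht
    let φ : ShortComplex.mk (biprod.inl : E ⟶ E ⊞ F) biprod.snd (by simp) ⟶
        ShortComplex.mk f g w :=
      { τ₁ := a
        τ₂ := biprod.desc (a ≫ f) t
        τ₃ := d
        comm₁₂ := by simp
        comm₂₃ := by apply biprod.hom_ext' <;> simp [w, ht] }
    have hbi := (ShortComplex.Splitting.ofHasBinaryBiproduct E F).shortExact
    have : Epi φ.τ₁ := ha
    have : Epi φ.τ₃ := hd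
    have : Epi (ShortComplex.mk f g w).g := hS.epi_g
    have hepi : Epi φ.τ₂ := ShortComplex.epi_τ₂_of_exact_of_epi φ hS.exact
    obtain ⟨f', g', w', hS'⟩ := exists_shortExact_kernel φ hbi hS
    exact ⟨E ⊞ F, φ.τ₂, inferInstance, hepi, _, _, _, _, _, hS', hKa, hKd⟩

/-- Gorenstein injective modules are closed under retracts. -/
lemma isGorensteinInjective_of_retract {M G : ModuleCat.{u} R} (i : M ⟶ G) (r : G ⟶ M)
    (hir : i ≫ r = 𝟙 M) (hG : IsGorensteinInjective G) : IsGorensteinInjective M := by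
  refine isGorensteinInjective_of_class (fun M => ∃ (G : ModuleCat.{u} R) (i : M ⟶ G)
    (r : G ⟶ M), i ≫ r = 𝟙 M ∧ IsGorensteinInjective G) ?_ ?_ ⟨G, i, r, hir, hG⟩
  · rintro M ⟨G, i, r, hir, hG⟩ I hI n
    exact subsingleton_ext_of_retract i r hir (hG.isInjectiveAcyclic I hI n)
  · rintro M ⟨G, i, r, hir, hG⟩
    have hir' (m : M) : r (i m) = m := congr($hir m)
    obtain ⟨E, g, hE, hg, hK⟩ := hG.exists_epi
    have : IsSplitEpi r := ⟨⟨i, hir⟩⟩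
    -- With `K = kernel (g ≫ r)`, there is an exact sequence `0 → kernel g → K × M → G → 0`. So `K ×
    -- M` is Gorenstein injective as an extension, and its summand `K` is again in the class.
    refine ⟨E, g ≫ r, hE, inferInstance, ModuleCat.of R ((kernel (g ≫ r) : ModuleCat R) × M),
      ModuleCat.ofHom (LinearMap.inl _ _ _), ModuleCat.ofHom (LinearMap.fst _ _ _), rfl, ?_⟩
    let k : kernel g ⟶ kernel (g ≫ r) :=
      kernel.lift _ (kernel.ι g) (by rw [kernel.condition_assoc, zero_comp])
    have hk (x) : kernel.ι (g ≫ r) (k x) = kernel.ι g x :=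
      congr($(kernel.lift_ι (g ≫ r) (kernel.ι g) _) x)
    let f : kernel g ⟶ ModuleCat.of R ((kernel (g ≫ r) : ModuleCat R) × M) :=
      ModuleCat.ofHom (LinearMap.inl _ _ _ ∘ₗ k.hom)
    let p : ModuleCat.of R ((kernel (g ≫ r) : ModuleCat R) × M) ⟶ G :=
      ModuleCat.ofHom ((g.hom ∘ₗ (kernel.ι (g ≫ r)).hom).coprod i.hom)
    have hp (x : (kernel (g ≫ r) : ModuleCat R)) (m : M) :
      p (x, m) = g (kernel.ι (g ≫ r) x) + i m := rfl
    have w : f ≫ p = 0 := by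
      ext x
      change g (kernel.ι (g ≫ r) (k x)) + i 0 = 0
      rw [hk, kernel_condition_apply, map_zero, add_zero]
    have hr (x) : r (g (kernel.ι (g ≫ r) x)) = 0 := kernel_condition_apply (g ≫ r) x
    refine isGorensteinInjective_of_shortExact (S := ShortComplex.mk f p w)
      { exact := ?_, mono_f := ?_, epi_g := ?_ } hK hG
    · rw [ShortComplex.moduleCat_exact_iff]
      rintro ⟨x, m⟩ (hx : g (kernel.ι (g ≫ r) x) + i m = 0)
      have h₁ := congrArg r hx
      rw [map_add, map_zero, hr, hir', zero_add] at h₁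
      subst h₁
      rw [map_zero, add_zero] at hx
      obtain ⟨y, hy⟩ := exists_kernel_ι_eq g _ hx
      exact ⟨y, Prod.ext (kernel_ι_injective _ ((hk y).trans hy)) rfl⟩
    · rw [ModuleCat.mono_iff_injective]
      intro x y hxy
      apply kernel_ι_injective
      rw [← hk, ← hk]
      exact congrArg _ (congrArg Prod.fst hxy)
    · rw [ModuleCat.epi_iff_surjective]
      intro (x : G)
      -- Split `x` into `i (r x)` and a remainder killed by `r`; any preimage of the remainder under
      -- `g` lies in `K`.
      obtain ⟨e, he⟩ := (ModuleCat.epi_iff_surjective g).1 hg (x - i (r x))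
      obtain ⟨z, hz⟩ := exists_kernel_ι_eq (g ≫ r) e (by
        change r (g e) = 0
        rw [he, map_sub, hir', sub_self])
      refine ⟨(z, r x), ?_⟩
      refine (hp z (r x)).trans ?_
      rw [hz, he, sub_add_cancel]

/-! ### Wakamatsu's lemma -/

/-- Wakamatsu's lemma: the kernel of an `L`-cover lies in `L^⊥` if `L` is closed under
extensions. -/
lemma IsCover.rightExtOrthogonal_kernel {L : ObjectProperty (ModuleCat.{u} R)}
    (hL : ∀ S : ShortComplex (ModuleCat.{u} R), S.ShortExact → L S.X₁ → L S.X₃ → L S.X₂)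
    {E X : ModuleCat.{u} R} {φ : E ⟶ X} (hφ : IsCover L φ) :
    rightExtOrthogonal L (kernel φ) := by
  intro F hF
  obtain ⟨⟨hE, hlift⟩, hiso⟩ := hφ
  let J := Injective.under E
  let ι : E ⟶ J := Injective.ι E
  have hι : Function.Injective ι := (ModuleCat.mono_iff_injective _).1 inferInstance
  let π : J ⟶ cokernel (kernel.ι φ ≫ ι) := cokernel.π (kernel.ι φ ≫ ι)
  have hT : (ShortComplex.mk (kernel.ι φ ≫ ι) π (cokernel.condition _)).ShortExact :=
    { exact := ShortComplex.exact_cokernel _ }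
  have hπ₀ (e : E) (he : φ e = 0) : π (ι e) = 0 := by
    obtain ⟨y, rfl⟩ := exists_kernel_ι_eq φ e he
    exact congr($(cokernel.condition (kernel.ι φ ≫ ι)) y)
  have hπ (j : J) (hj : π j = 0) : ∃ e : E, φ e = 0 ∧ ι e = j := by
    obtain ⟨y, rfl⟩ := (ShortComplex.moduleCat_exact_iff _).1 hT.exact j hj
    exact ⟨kernel.ι φ y, kernel_condition_apply φ y, rfl⟩
  refine subsingleton_ext_one_of_exists_lift hT (Abelian.Ext.subsingleton_of_injective _ _ _) ?_
  intro (v : F ⟶ cokernel (kernel.ι φ ≫ ι))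
  -- Pulling back `π` along `v` gives an extension of `F` by `kernel φ`, and `P` models its pushout
  -- along `kernel φ ⟶ E`. A pair `(e, (j, f))` with `π j = v f` becomes `(ι e + j, f, φ e)`. Thus
  -- `P` is an extension of `F` by `E`, and the third coordinate extends `φ`.
  let P : Submodule R (J × F × X) :=
    { carrier := {p | ∃ e : E, φ e = p.2.2 ∧ π (ι e) + v p.2.1 = π p.1}
      add_mem' := by
        rintro _ _ ⟨e, h₁, h₂⟩ ⟨e', h₁', h₂'⟩
        refine ⟨e + e', ?_, ?_⟩
        · rw [map_add, h₁, h₁']; rfl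
        · simp only [Prod.fst_add, Prod.snd_add, map_add]
          rw [← h₂, ← h₂']
          abel
      zero_mem' := ⟨0, by simp⟩
      smul_mem' := by
        rintro c _ ⟨e, h₁, h₂⟩
        refine ⟨c • e, ?_, ?_⟩
        · rw [map_smul, h₁]; rfl
        · simp only [Prod.smul_fst, Prod.smul_snd, map_smul]
          rw [← h₂, smul_add] }
  let a : E ⟶ ModuleCat.of R P := ModuleCat.ofHom
    ((ι.hom.prod (LinearMap.prod 0 φ.hom)).codRestrict P fun e =>
      ⟨e, rfl, by change _ + v 0 = _; rw [map_zero, add_zero]; rfl⟩)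
  let b : ModuleCat.of R P ⟶ F := ModuleCat.ofHom
    (LinearMap.fst R F X ∘ₗ LinearMap.snd R J (F × X) ∘ₗ P.subtype)
  let ψ : ModuleCat.of R P ⟶ X := ModuleCat.ofHom
    (LinearMap.snd R F X ∘ₗ LinearMap.snd R J (F × X) ∘ₗ P.subtype)
  let q : ModuleCat.of R P ⟶ J := ModuleCat.ofHom (LinearMap.fst R J (F × X) ∘ₗ P.subtype)
  have haq : a ≫ q = ι := rfl
  have haψ : a ≫ ψ = φ := rfl
  have hab : a ≫ b = 0 := rfl
  have hP (p : P) : ∃ e : E, φ e = ψ p ∧ π (ι e) + v (b p) = π (q p) := p.2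
  have hS : (ShortComplex.mk a b hab).ShortExact := by
    refine { exact := ?_, mono_f := ?_, epi_g := ?_ }
    · rw [ShortComplex.moduleCat_exact_iff]
      intro (p : P) hp
      replace hp : b p = 0 := hp
      obtain ⟨e, h₁, h₂⟩ := hP p
      rw [hp, map_zero, add_zero, eq_comm, ← sub_eq_zero, ← map_sub] at h₂
      obtain ⟨e', h₃, h₄⟩ := hπ _ h₂
      refine ⟨e + e', Subtype.ext (Prod.ext ?_ (Prod.ext hp.symm ?_))⟩
      · change ι (e + e') = q p
        rw [map_add, h₄, add_sub_cancel]
      · change φ (e + e') = ψ p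
        rw [map_add, h₃, h₁, add_zero]
    · have : Mono (a ≫ q) := by rw [haq]; infer_instance
      exact mono_of_mono a q
    · rw [ModuleCat.epi_iff_surjective]
      intro x
      obtain ⟨j, hj⟩ := hT.moduleCat_surjective_g (v x)
      refine ⟨⟨(j, x, 0), 0, map_zero _, ?_⟩, rfl⟩
      change π (ι 0) + v x = π j
      rw [map_zero, map_zero, zero_add]
      exact hj.symm
  obtain ⟨h, hh⟩ := hlift (ModuleCat.of R P) (hL _ hS hE hF) ψ
  -- The cover property makes this endomorphism over `X` invertible, so `h` can be corrected to a
  -- retraction `h'` of `a` that still lies over `X`.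
  have : IsIso (a ≫ h) := hiso _ (by rw [Category.assoc, hh, haψ])
  let h' := h ≫ inv (a ≫ h)
  have hah' : a ≫ h' = 𝟙 E := by rw [← Category.assoc, IsIso.hom_inv_id]
  have hh' : h' ≫ φ = ψ := by
    have : inv (a ≫ h) ≫ φ = φ := by
      rw [IsIso.inv_comp_eq, Category.assoc, hh, haψ]
    rw [Category.assoc, this, hh]
  have : Epi b := hS.epi_g
  -- The difference `q - h' ≫ ι` vanishes on `E`, hence descends to `F`. It lifts `v` because `e`
  -- and `h' p` have the same image in `X`, so `π ∘ ι` does not distinguish them.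
  have hd : a ≫ (q - h' ≫ ι) = 0 := by
    rw [Preadditive.comp_sub, haq, reassoc_of% hah', sub_self]
  refine ⟨hS.exact.desc (q - h' ≫ ι) hd, ?_⟩
  rw [← cancel_epi b]
  have := hS.exact.g_desc (q - h' ≫ ι) hd
  dsimp only at this ⊢
  rw [reassoc_of% this]
  ext p
  obtain ⟨e, h₁, h₂⟩ := hP p
  have h₃ : φ (h' p) = ψ p := congr($hh' p)
  have h₄ := hπ₀ (e - h' p) (by rw [map_sub, h₁, h₃, sub_self])
  rw [map_sub, map_sub, sub_eq_zero] at h₄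
  change π (q p - ι (h' p)) = v (b p)
  rw [map_sub, ← h₂, h₄, add_sub_cancel_left]

lemma IsCovering.isSpecialPrecovering {L : ObjectProperty (ModuleCat.{u} R)}
    (hL : ∀ S : ShortComplex (ModuleCat.{u} R), S.ShortExact → L S.X₁ → L S.X₃ → L S.X₂)
    (h : IsCovering L) : IsSpecialPrecovering L := fun X => by
  obtain ⟨E, φ, hφ⟩ := h X
  exact ⟨E, φ, hφ.1, hφ.rightExtOrthogonal_kernel hL⟩

/-! ### Filtrations and Eklof's lemma -/

lemma IsFiltration.of_le {C D : ObjectProperty (ModuleCat.{u} R)} (hCD : ∀ A, C A → D A)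
    {M : ModuleCat.{u} R} {lam : Ordinal.{u}} {N : Ordinal.{u} → Submodule R M}
    (hN : IsFiltration C M lam N) : IsFiltration D M lam N where
  mono := hN.mono
  zero := hN.zero
  top := hN.top
  limit := hN.limit
  quot α hα := by
    obtain ⟨A, hA, e⟩ := hN.quot α hα
    exact ⟨A, hCD A hA, e⟩

/-- The stage is the one at `sSup A`: an unattained supremum is a limit ordinal, where the
filtration is continuous. This keeps domains of unions of chains among the stages in the Zorn
argument below. -/
lemma IsFiltration.exists_eq_sSup_image {C : ObjectProperty (ModuleCat.{u} R)}
    {M : ModuleCat.{u} R} {lam : Ordinal.{u}} {N : Ordinal.{u} → Submodule R M}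
    (hN : IsFiltration C M lam N) {β : Ordinal.{u}} (hβ : β ≤ lam) {A : Set Ordinal.{u}}
    (hA : A.Nonempty) (hAβ : ∀ α ∈ A, α ≤ β) : ∃ γ ≤ β, N γ = sSup (N '' A) := by
  have hbdd : BddAbove A := ⟨β, hAβ⟩
  have hγ : sSup A ≤ β := csSup_le hA hAβ
  refine ⟨sSup A, hγ, le_antisymm ?_ ?_⟩
  · by_cases hmem : sSup A ∈ A
    · exact le_sSup ⟨_, hmem, rfl⟩
    · have hlim : Order.IsSuccLimit (sSup A) := (isLUB_csSup hA hbdd).isSuccLimit_of_notMem hA hmem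
      rw [hN.limit _ hlim (hγ.trans hβ)]
      refine iSup_le fun ⟨α, hα⟩ => ?_
      obtain ⟨a, ha, haα⟩ := exists_lt_of_lt_csSup hA hα
      exact (hN.mono _ _ haα.le ((hAβ a ha).trans hβ)).trans (le_sSup ⟨a, ha, rfl⟩)
  · refine sSup_le ?_
    rintro _ ⟨a, ha, rfl⟩
    exact hN.mono _ _ (le_csSup hbdd ha) (hγ.trans hβ)

/-- Extension of a lift from a submodule `A` to a submodule `B` when maps from `B / A` lift. -/
lemma exists_lift_of_quotient {M I Q : ModuleCat.{u} R} (hI : Injective I) (π : I ⟶ Q)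
    {A B : Submodule R M} (hAB : A ≤ B)
    (h : ∀ w : (↥B ⧸ A.submoduleOf B) →ₗ[R] Q, ∃ t : (↥B ⧸ A.submoduleOf B) →ₗ[R] I,
      π.hom ∘ₗ t = w)
    (v : B →ₗ[R] Q) (f : A →ₗ[R] I) (hf : π.hom ∘ₗ f = v ∘ₗ Submodule.inclusion hAB) :
    ∃ g : B →ₗ[R] I, g ∘ₗ Submodule.inclusion hAB = f ∧ π.hom ∘ₗ g = v := by
  let i : ModuleCat.of R A ⟶ ModuleCat.of R B := ModuleCat.ofHom (Submodule.inclusion hAB)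
  have : Mono i := (ModuleCat.mono_iff_injective _).2 (Submodule.inclusion_injective hAB)
  -- Extend `f` by injectivity, ignoring `v`. The error `v - π ∘ k` vanishes on `A`, so it factors
  -- through `B / A`, lifts to `I`, and can be added back without changing the values on `A`.
  let k : ModuleCat.of R B ⟶ I := Injective.factorThru (ModuleCat.ofHom f) i
  have hk (x : A) : k.hom (Submodule.inclusion hAB x) = f x :=
    congr($(Injective.comp_factorThru (ModuleCat.ofHom f) i) x)
  have hker : A.submoduleOf B ≤ LinearMap.ker (v - π.hom ∘ₗ k.hom) := by
    rintro ⟨x, hx⟩ hxA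
    have h₁ := hk ⟨x, hxA⟩
    have h₂ := LinearMap.congr_fun hf ⟨x, hxA⟩
    rw [LinearMap.mem_ker, LinearMap.sub_apply, sub_eq_zero]
    exact h₂.symm.trans (congrArg π.hom h₁.symm)
  obtain ⟨t, ht⟩ := h ((A.submoduleOf B).liftQ _ hker)
  refine ⟨k.hom + t ∘ₗ (A.submoduleOf B).mkQ, ?_, ?_⟩
  · ext x
    have : (A.submoduleOf B).mkQ (Submodule.inclusion hAB x) = 0 := by
      rw [Submodule.mkQ_apply, Submodule.Quotient.mk_eq_zero]
      exact x.2
    simp only [LinearMap.add_comp, LinearMap.add_apply, LinearMap.comp_apply, this, map_zero,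
      add_zero, hk]
  · rw [LinearMap.comp_add, ← LinearMap.comp_assoc, ht, Submodule.liftQ_mkQ, add_sub_cancel]

/-- Eklof's lemma: if every map from a subquotient of a filtration to `Q` lifts along `π : I ⟶ Q`
with `I` injective, then so does every map from a member of the filtration. -/
lemma IsFiltration.exists_lift {C : ObjectProperty (ModuleCat.{u} R)}
    {M : ModuleCat.{u} R} {lam : Ordinal.{u}} {N : Ordinal.{u} → Submodule R M}
    (hN : IsFiltration C M lam N) {I Q : ModuleCat.{u} R} (hI : Injective I) (π : I ⟶ Q)
    (h : ∀ D, C D → ∀ w : D ⟶ Q, ∃ t : D ⟶ I, t ≫ π = w)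
    {β : Ordinal.{u}} (hβ : β ≤ lam) (v : N β →ₗ[R] Q) :
    ∃ t : N β →ₗ[R] I, π.hom ∘ₗ t = v := by
  -- Zorn's lemma is applied to partial lifts of `v` whose domain is a stage of the filtration.
  let S : Set (M →ₗ.[R] I) := {f | ∃ α ≤ β, f.domain = N α ∧
    ∀ (x : M) (hx : x ∈ f.domain) (hx' : x ∈ N β), π (f ⟨x, hx⟩) = v ⟨x, hx'⟩}
  have hS₀ : (⊥ : M →ₗ.[R] I) ∈ S := by
    refine ⟨0, zero_le, hN.zero.symm, fun x hx hx' => ?_⟩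
    obtain rfl : x = 0 := (Submodule.mem_bot R).1 hx
    have h₁ : (⟨0, hx⟩ : (⊥ : M →ₗ.[R] I).domain) = 0 := rfl
    have h₂ : (⟨0, hx'⟩ : N β) = 0 := rfl
    rw [h₁, h₂, LinearPMap.map_zero, map_zero, map_zero]
  obtain ⟨f, -, hf⟩ := zorn_le_nonempty₀ S (fun c hcS hc f₀ hf₀ => by
    have hd := hc.directedOn
    refine ⟨LinearPMap.sSup c hd, ?_, fun f hf => LinearPMap.le_sSup hd hf⟩
    choose! a ha hdom hval using hcS
    obtain ⟨γ, hγ, hγ'⟩ := hN.exists_eq_sSup_image hβ (A := a '' c) ⟨_, f₀, hf₀, rfl⟩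
      (by rintro _ ⟨f, hf, rfl⟩; exact ha hf)
    refine ⟨γ, hγ, ?_, fun x hx hx' => ?_⟩
    · rw [hγ', LinearPMap.domain_sSup, Set.image_image]
      exact congrArg sSup (Set.image_congr fun f hf => hdom hf)
    · obtain ⟨f, hfc, hxf⟩ := (LinearPMap.mem_domain_sSup_iff ⟨f₀, hf₀⟩ hd).1 hx
      rw [← (LinearPMap.le_sSup hd hfc).2 (x := ⟨x, hxf⟩) (y := ⟨x, hx⟩) rfl]
      exact hval hfc x hxf hx') ⊥ hS₀
  obtain ⟨α, hα, hdom, hval⟩ := hf.prop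
  -- A maximal partial lift is defined on every stage: at a successor outside the known domain,
  -- lifting from the quotient gives an extension, which maximality forces back into `f`.
  have key : ∀ γ ≤ β, N γ ≤ f.domain := by
    intro γ
    induction γ using SuccOrder.limitRecOn with
    | isMin γ hγ =>
      obtain rfl : γ = 0 := by simpa using hγ
      exact fun _ => hN.zero.trans_le bot_le
    | succ γ _ ih =>
      intro hγ
      have hγβ : γ < β := Order.succ_le_iff.1 hγ
      rcases le_or_gt α γ with hαγ | hγα
      · have hNγ : N γ = f.domain :=
          le_antisymm (ih hγβ.le) (hdom.trans_le (hN.mono _ _ hαγ (hγβ.le.trans hβ)))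
        have hle : f.domain ≤ N (Order.succ γ) :=
          hNγ.symm.trans_le (hN.mono _ _ (Order.le_succ γ) (hγ.trans hβ))
        have hleβ : N (Order.succ γ) ≤ N β := hN.mono _ _ hγ hβ
        obtain ⟨D, hD, ⟨e⟩⟩ := hN.quot γ (hγβ.trans_le hβ)
        rw [hNγ] at e
        obtain ⟨g, hg₁, hg₂⟩ := exists_lift_of_quotient hI π hle (fun w => by
          obtain ⟨t, ht⟩ := h D hD (ModuleCat.ofHom (w ∘ₗ e.symm.toLinearMap))
          refine ⟨t.hom ∘ₗ e.toLinearMap, ?_⟩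
          ext x
          have := congr($ht (e (Submodule.Quotient.mk x)))
          simpa using this) (v ∘ₗ Submodule.inclusion hleβ) f.toFun (by
          ext x
          exact hval x x.2 _)
        have hfg : f ≤ ⟨N (Order.succ γ), g⟩ := by
          refine ⟨hle, fun x y hxy => ?_⟩
          obtain rfl : Submodule.inclusion hle x = y := Subtype.ext hxy
          exact (LinearMap.congr_fun hg₁ x).symm
        have hmem : (⟨N (Order.succ γ), g⟩ : M →ₗ.[R] I) ∈ S :=
          ⟨Order.succ γ, hγ, rfl, fun x hx _ => LinearMap.congr_fun hg₂ ⟨x, hx⟩⟩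
        exact (hf.le_of_ge hmem hfg).1
      · rw [hdom]
        exact hN.mono _ _ (Order.succ_le_of_lt hγα) (hα.trans hβ)
    | isSuccLimit γ hγ ih =>
      intro hγβ
      rw [hN.limit γ hγ (hγβ.trans hβ)]
      exact iSup_le fun δ => ih δ δ.2 (le_of_lt (δ.2.trans_le hγβ))
  refine ⟨f.toFun ∘ₗ Submodule.inclusion (key β le_rfl), ?_⟩
  ext x
  exact hval x _ x.2

/-- Transfinite induction over the stages: successors are extensions, and a limit stage is a retract
of its special precover. -/
lemma IsFiltration.isGorensteinInjective (hR : IsSpecialPrecovering (GI R))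
    {M : ModuleCat.{u} R} {lam : Ordinal.{u}} {N : Ordinal.{u} → Submodule R M}
    (hN : IsFiltration (GI R) M lam N) {β : Ordinal.{u}} (hβ : β ≤ lam) :
    IsGorensteinInjective (ModuleCat.of R (N β)) := by
  induction β using SuccOrder.limitRecOn with
  | isMin β hmin =>
    obtain rfl : β = 0 := by simpa using hmin
    have : Subsingleton (N 0) := by rw [hN.zero]; infer_instance
    exact isGorensteinInjective_of_isZero (ModuleCat.isZero_of_subsingleton _)
  | succ β _ ih =>
    have hlt : β < lam := Order.succ_le_iff.1 hβ
    obtain ⟨D, hD, ⟨e⟩⟩ := hN.quot β hlt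
    have hle : N β ≤ N (Order.succ β) := hN.mono _ _ (Order.le_succ β) hβ
    let f : ModuleCat.of R (N β) ⟶ ModuleCat.of R (N (Order.succ β)) :=
      ModuleCat.ofHom (Submodule.inclusion hle)
    let g : ModuleCat.of R (N (Order.succ β)) ⟶
        ModuleCat.of R (↥(N (Order.succ β)) ⧸ (N β).submoduleOf (N (Order.succ β))) :=
      ModuleCat.ofHom (Submodule.mkQ _)
    have w : f ≫ g = 0 := by
      ext x
      exact (Submodule.Quotient.mk_eq_zero _).2 x.2
    refine isGorensteinInjective_of_shortExact (S := ShortComplex.mk f g w)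
      { exact := ?_, mono_f := ?_, epi_g := ?_ } (ih hlt.le)
      (isGorensteinInjective_of_iso e.toModuleIso hD)
    · rw [ShortComplex.moduleCat_exact_iff]
      intro (x : N (Order.succ β)) hx
      have hx' : x ∈ (N β).submoduleOf (N (Order.succ β)) :=
        (Submodule.Quotient.mk_eq_zero _).1 hx
      exact ⟨⟨x, hx'⟩, rfl⟩
    · exact (ModuleCat.mono_iff_injective _).2 (Submodule.inclusion_injective hle)
    · exact (ModuleCat.epi_iff_surjective _).2 (Submodule.mkQ_surjective _)
  | isSuccLimit β hlim ih =>
    obtain ⟨E, φ, ⟨hE, hlift⟩, hK⟩ := hR (ModuleCat.of R (N β))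
    -- Earlier stages are Gorenstein injective by induction, so their inclusions factor through `φ`;
    -- their union is everything.
    have hsurj : LinearMap.range φ.hom = ⊤ := by
      have hle : N β ≤ (LinearMap.range φ.hom).map (N β).subtype := by
        conv_lhs => rw [hN.limit β hlim hβ]
        refine iSup_le fun ⟨α, (hα : α < β)⟩ x hx => ?_
        obtain ⟨h, hh⟩ := hlift (ModuleCat.of R (N α)) (ih α hα (hα.le.trans hβ))
          (ModuleCat.ofHom (Submodule.inclusion (hN.mono _ _ hα.le hβ)))
        exact ⟨_, ⟨h ⟨x, hx⟩, rfl⟩, congr(($hh ⟨x, hx⟩ : N β).1)⟩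
      refine eq_top_iff.2 fun x _ => ?_
      obtain ⟨y, hy, hyx⟩ := hle x.2
      rwa [← Subtype.ext (a1 := y) (a2 := x) hyx]
    have : Epi φ := (ModuleCat.epi_iff_range_eq_top φ).2 hsurj
    have hS : (ShortComplex.mk (kernel.ι φ) φ (kernel.condition φ)).ShortExact :=
      { exact := ShortComplex.exact_kernel φ }
    let ι := Injective.ι (kernel φ)
    have hT : (ShortComplex.mk ι (cokernel.π ι) (cokernel.condition ι)).ShortExact :=
      { exact := ShortComplex.exact_cokernel ι }
    have hext : Subsingleton (Abelian.Ext (ModuleCat.of R (N β)) (kernel φ) 1) := by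
      refine subsingleton_ext_one_of_exists_lift hT
        (Abelian.Ext.subsingleton_of_injective _ _ _) fun v => ?_
      obtain ⟨t, ht⟩ := hN.exists_lift inferInstance (cokernel.π ι)
        (fun D hD w => exists_lift_of_subsingleton_ext hT (hK D hD) w) hβ v.hom
      exact ⟨ModuleCat.ofHom t, ModuleCat.hom_ext ht⟩
    obtain ⟨s, hs⟩ := exists_lift_of_subsingleton_ext hS hext (𝟙 _)
    exact isGorensteinInjective_of_retract s φ hs hE

lemma isGorensteinInjective_of_filt (hR : IsSpecialPrecovering (GI R)) {M : ModuleCat.{u} R}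
    (hM : Filt (GI R) M) : IsGorensteinInjective M := by
  obtain ⟨lam, N, hN⟩ := hM
  exact isGorensteinInjective_of_iso
    ((LinearEquiv.ofTop (N lam) hN.top).symm.toModuleIso)
    (hN.isGorensteinInjective hR le_rfl)

/-! ### From direct systems to filtrations -/

/-- Every module that is a direct transfinite extension of objects of `L` is `L`-filtered. -/
lemma IsDirectTransfiniteExtension.exists_filt {L : ObjectProperty (ModuleCat.{u} R)}
    {X : ModuleCat.{u} R} (hX : IsDirectTransfiniteExtension L X) :
    ∃ M : ModuleCat.{u} R, Nonempty (X ≅ M) ∧ Filt L M := by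
  obtain ⟨lam, F, ⟨hzero, hcont⟩, hmono, hcoker, c, ⟨hc⟩, ⟨e⟩⟩ := hX
  let T : Set.Iic lam := ⟨lam, Set.mem_Iic.2 le_rfl⟩
  -- The index set has a greatest element, so the colimit is the last term, and the stages are the
  -- images of the other terms in it.
  have hT : IsTerminal T := IsTerminal.ofUniqueHom (fun a => homOfLE a.2) fun _ _ => rfl
  refine ⟨F.obj T, ⟨e ≪≫ hc.coconePointUniqueUpToIso (colimitOfDiagramTerminal hT F)⟩, lam, ?_⟩
  let m (α : Ordinal.{u}) (h : α ≤ lam) : F.obj ⟨α, h⟩ ⟶ F.obj T := F.map (homOfLE h)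
  have hm (α β : Ordinal.{u}) (hαβ : α ≤ β) (hβ : β ≤ lam) :
      m α (hαβ.trans hβ) = F.map (homOfLE (by exact hαβ)) ≫ m β hβ := by
    rw [← F.map_comp]; rfl
  -- The supremum over proofs of `α ≤ lam` makes `N` total, with value `⊥` beyond `lam`.
  let N (α : Ordinal.{u}) : Submodule R (F.obj T) :=
    ⨆ h : α ≤ lam, LinearMap.range (m α h).hom
  have hNeq (α : Ordinal.{u}) (h : α ≤ lam) : N α = LinearMap.range (m α h).hom :=
    iSup_pos h
  refine ⟨N, ?_, ?_, ?_, ?_, ?_⟩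
  · intro α β hαβ hβ
    rw [hNeq α (hαβ.trans hβ), hNeq β hβ, hm α β hαβ hβ, ModuleCat.hom_comp]
    exact LinearMap.range_comp_le_range _ _
  · rw [hNeq 0 zero_le, hzero.eq_of_src (m 0 zero_le) 0, ModuleCat.hom_zero, LinearMap.range_zero]
  · rw [hNeq lam le_rfl]
    have : m lam le_rfl = 𝟙 _ := F.map_id T
    rw [this, ModuleCat.hom_id, LinearMap.range_id]
  · intro β hβ hβlam
    refine le_antisymm ?_ ?_
    · obtain ⟨hcol⟩ := hcont ⟨β, hβlam⟩ hβ
      -- Modulo the union of the earlier stages, the map from the colimit `F β` vanishes on every `F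
      -- α` with `α < β`, hence is zero.
      have hz : m β hβlam ≫ ModuleCat.ofHom (Submodule.mkQ (⨆ α : Set.Iio β, N α)) = 0 := by
        refine hcol.hom_ext fun ⟨⟨α, hα⟩, (hαβ : α < β)⟩ => ?_
        refine Eq.trans ?_ comp_zero.symm
        ext x
        refine (Submodule.Quotient.mk_eq_zero _).2 ?_
        refine Submodule.mem_iSup_of_mem (⟨α, hαβ⟩ : Set.Iio β) ?_
        rw [hNeq α hα, hm α β hαβ.le hβlam]
        exact ⟨x, rfl⟩
      rw [hNeq β hβlam]
      rintro _ ⟨x, rfl⟩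
      exact (Submodule.Quotient.mk_eq_zero _).1 congr($hz x)
    · refine iSup_le fun ⟨α, (hα : α < β)⟩ => ?_
      rw [hNeq α (hα.le.trans hβlam), hNeq β hβlam, hm α β hα.le hβlam, ModuleCat.hom_comp]
      exact LinearMap.range_comp_le_range _ _
  · intro α hα
    have hs : Order.succ α ≤ lam := Order.succ_le_of_lt hα
    let a : F.obj ⟨α, hα.le⟩ ⟶ F.obj ⟨Order.succ α, hs⟩ := F.map (homOfLE (Order.le_succ α))
    have hinj : Function.Injective (m _ hs).hom :=
      (ModuleCat.mono_iff_injective _).1 (hmono _ _ _)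
    refine ⟨cokernel a, hcoker _ _ _ rfl, ⟨?_⟩⟩
    rw [hNeq _ hs, hNeq α hα.le]
    refine (Submodule.Quotient.equiv (LinearMap.range a.hom) _
      (LinearEquiv.ofInjective (m _ hs).hom hinj) ?_).symm.trans
      (ModuleCat.cokernelIsoRangeQuotient a).symm.toLinearEquiv
    rw [hm α _ (Order.le_succ α) hs]
    ext x
    constructor
    · rintro ⟨_, ⟨y, rfl⟩, rfl⟩
      exact ⟨y, rfl⟩
    · rintro ⟨y, hy⟩
      exact ⟨_, ⟨y, rfl⟩, Subtype.ext hy⟩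

end

end GorInj


theorem mainTheorem5 (R : Type u) [Ring R] [IsNoetherianRing R] [IsNoetherianRing Rᵐᵒᵖ] :
    (GorInj.IsSpecialPrecovering (GorInj.GI R) →
      GorInj.IsClosedUnderDirectTransfiniteExtensions (GorInj.GI R)) ∧
    (GorInj.IsCovering (GorInj.GI R) → GorInj.IsSpecialPrecovering (GorInj.GI R)) ∧
    (GorInj.IsCovering (GorInj.GI R) →
      GorInj.IsClosedUnderDirectTransfiniteExtensions (GorInj.GI R)) ∧
    (GorInj.IsSpecialPrecovering (GorInj.GI R) →
      ∀ (κ : Cardinal.{u}) (X : ObjectProperty (ModuleCat.{u} R)),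
        GorInj.IsSmallGIRepresentatives κ X →
        ∀ M : ModuleCat.{u} R, GorInj.Filt X M → GorInj.GI R M) := by
  have h₁ (h : GorInj.IsSpecialPrecovering (GorInj.GI R)) :
      GorInj.IsClosedUnderDirectTransfiniteExtensions (GorInj.GI R) := fun X hX => by
    obtain ⟨M, ⟨e⟩, hM⟩ := hX.exists_filt
    exact GorInj.isGorensteinInjective_of_iso e (GorInj.isGorensteinInjective_of_filt h hM)
  have h₂ (h : GorInj.IsCovering (GorInj.GI R)) : GorInj.IsSpecialPrecovering (GorInj.GI R) :=
    h.isSpecialPrecovering fun _ hS => GorInj.isGorensteinInjective_of_shortExact hS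
  refine ⟨h₁, h₂, fun h => h₁ (h₂ h), fun h κ X hX M ⟨lam, N, hN⟩ => ?_⟩
  exact GorInj.isGorensteinInjective_of_filt h ⟨lam, N, hN.of_le fun A hA => (hX.1 A hA).1⟩
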